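/- Let $E$ be a complex Banach lattice, i.e. the complexification $E = X \oplus iX$ of a real Banach lattice $X$ with modulus $|x+iy| = \sup_{\theta\in\mathbb{R}} (\cos\theta\, x + \sin\theta\, y)$ and norm $\|x+iy\| = \|\,|x+iy|\,\|$. Let $T : E \to E$ be a bounded linear operator that is uniformly eventually positive, i.e. there is $n_0 \in \mathbb{N}_0$ such that for every $n \ge n_0$ the operator $T^n$ is positive ($T^n f \ge 0$ for all $f \in E$ with $f \ge 0$). Suppose that the spectral radius $r(T)$ is a Riesz point of $T$, i.e. a spectral value of $T$ that is a pole of the resolvent $z \mapsto (zI-T)^{-1}$ and whose spectral space (the range of the associated spectral projection $\frac{1}{2\pi i}\oint (zI-T)^{-1}\,dz$, where the integral is over a circle around $r(T)$ such that the closed disk it bounds contains no other point of the spectrum) is finite-dimensional. Suppose moreover that $r(T)$ is a pole of the resolvent of order $1$. Then $$\dim\ker(\lambda I - T) \le \dim\ker(r(T) I - T)$$ for every $\lambda \in \mathbb{C}$ with $|\lambda| = r(T)$. -/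

import Mathlib

section RealBanachLattice

variable {X : Type*} [NormedAddCommGroup X] [NormedSpace ℝ X] [Lattice X]
  [IsOrderedAddMonoid X] [IsOrderedModule ℝ X]

/-- The real part of `e^{-iθ} (x + i y)`. -/
noncomputable def rotatedRe (x y : X) (θ : ℝ) : X := Real.cos θ • x + Real.sin θ • y

theorem rotatedRe_le (x y : X) (θ η : ℝ) :
    rotatedRe x y θ ≤ rotatedRe x y η + |θ - η| • (|x| + |y|) := by
  have key : ∀ (c : ℝ) (v : X), |c| ≤ |θ - η| → c • v ≤ |θ - η| • |v| := by
    intro c v hc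
    have h1 : c • v ≤ |c| • |v| := by
      rcases le_total 0 c with h | h
      · rw [abs_of_nonneg h]
        exact smul_le_smul_of_nonneg_left (le_abs_self v) h
      · rw [abs_of_nonpos h, ← neg_smul_neg c v]
        exact smul_le_smul_of_nonneg_left (neg_le_abs v) (neg_nonneg.2 h)
    exact h1.trans (smul_le_smul_of_nonneg_right hc (abs_nonneg v))
  have e : rotatedRe x y θ = rotatedRe x y η
      + ((Real.cos θ - Real.cos η) • x + (Real.sin θ - Real.sin η) • y) := by
    unfold rotatedRe
    module
  rw [e, smul_add]
  gcongr
  · exact key _ _ (Real.abs_cos_sub_cos_le θ η)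
  · exact key _ _ (Real.abs_sin_sub_sin_le θ η)

variable [HasSolidNorm X]

/-- In a real Banach lattice, the supremum over all `θ` of the real part of `e^{-iθ} (x + i y)`
exists. -/
theorem exists_isLUB_rotatedRe [CompleteSpace X] (x y : X) :
    ∃ m : X, IsLUB (Set.range (rotatedRe x y)) m := by
  have hne : ∀ n : ℕ, (Finset.range (7 * (n + 1))).Nonempty := fun n =>
    ⟨0, Finset.mem_range.2 (by positivity)⟩
  -- suprema over finer and finer finite grids of angles
  let s : ℕ → X := fun n => (Finset.range (7 * (n + 1))).sup' (hne n)
    (fun k => rotatedRe x y ((k : ℝ) / (n + 1)))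
  let w : X := |x| + |y|
  have hw : 0 ≤ w := add_nonneg (abs_nonneg x) (abs_nonneg y)
  have h1 : ∀ (n : ℕ) (θ : ℝ), rotatedRe x y θ ≤ s n + (1 / ((n : ℝ) + 1)) • w := by
    intro n θ
    have hper : rotatedRe x y θ = rotatedRe x y (toIcoMod Real.two_pi_pos 0 θ) := by
      have h := toIcoMod_add_toIcoDiv_zsmul Real.two_pi_pos 0 θ
      unfold rotatedRe
      conv_lhs => rw [← h]
      rw [zsmul_eq_mul, Real.cos_add_int_mul_two_pi, Real.sin_add_int_mul_two_pi]
    rw [hper]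
    obtain ⟨ha, hb⟩ := toIcoMod_mem_Ico Real.two_pi_pos 0 θ
    generalize toIcoMod Real.two_pi_pos 0 θ = φ at ha hb
    have hn : (0 : ℝ) < n + 1 := by positivity
    have hfl : (⌊φ * (n + 1)⌋₊ : ℝ) ≤ φ * (n + 1) := Nat.floor_le (by positivity)
    have hfl' : φ * (n + 1) < ⌊φ * (n + 1)⌋₊ + 1 := Nat.lt_floor_add_one _
    have hk : ⌊φ * (n + 1)⌋₊ ∈ Finset.range (7 * (n + 1)) := by
      rw [Finset.mem_range, Nat.floor_lt (by positivity)]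
      push_cast
      have : φ < 7 := by linarith [Real.pi_lt_d2]
      gcongr
    have hs : rotatedRe x y ((⌊φ * (n + 1)⌋₊ : ℝ) / (n + 1)) ≤ s n :=
      Finset.le_sup' (fun k : ℕ => rotatedRe x y ((k : ℝ) / (n + 1))) hk
    have hd : |φ - (⌊φ * (n + 1)⌋₊ : ℝ) / (n + 1)| ≤ 1 / ((n : ℝ) + 1) := by
      have e : φ - (⌊φ * (n + 1)⌋₊ : ℝ) / (n + 1)
          = (φ * (n + 1) - ⌊φ * (n + 1)⌋₊) / (n + 1) := by field_simp
      rw [e, abs_of_nonneg (div_nonneg (by linarith) hn.le)]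
      gcongr
      linarith
    exact (rotatedRe_le x y φ _).trans (add_le_add hs (smul_le_smul_of_nonneg_right hd hw))
  have h2 : ∀ (n : ℕ) (b : X), b ∈ upperBounds (Set.range (rotatedRe x y)) → s n ≤ b :=
    fun n b hb => Finset.sup'_le _ _ fun k _ => hb ⟨_, rfl⟩
  have h3 : ∀ N m n : ℕ, N ≤ m → N ≤ n → s m - s n ≤ (1 / ((N : ℝ) + 1)) • w := by
    intro N m n _ hn
    rw [sub_le_iff_le_add']
    refine (h2 m (s n + (1 / ((n : ℝ) + 1)) • w) ?_).trans ?_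
    · rintro _ ⟨θ, rfl⟩
      exact h1 n θ
    · exact add_le_add le_rfl
        (smul_le_smul_of_nonneg_right (Nat.one_div_le_one_div hn) hw)
  have hlim : Filter.Tendsto (fun n : ℕ => 1 / ((n : ℝ) + 1)) Filter.atTop (nhds 0) :=
    tendsto_one_div_add_atTop_nhds_zero_nat
  have hc : CauchySeq s := by
    refine cauchySeq_of_le_tendsto_0 (fun N : ℕ => 1 / ((N : ℝ) + 1) * ‖w‖) ?_ ?_
    · intro m n N hm hn
      rw [dist_eq_norm]
      have hab : |s m - s n| ≤ |(1 / ((N : ℝ) + 1)) • w| :=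
        (abs_le'.2 ⟨h3 N m n hm hn, by rw [neg_sub]; exact h3 N n m hn hm⟩).trans
          (le_abs_self _)
      refine (norm_le_norm_of_abs_le_abs hab).trans ?_
      rw [norm_smul, Real.norm_of_nonneg (by positivity)]
    · simpa using hlim.mul_const ‖w‖
  obtain ⟨m, hm⟩ := cauchySeq_tendsto_of_complete hc
  refine ⟨m, ?_, fun b hb => le_of_tendsto' hm fun n => h2 n b hb⟩
  rintro _ ⟨θ, rfl⟩
  have h4 : Filter.Tendsto (fun n : ℕ => s n + (1 / ((n : ℝ) + 1)) • w) Filter.atTop (nhds m) := by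
    simpa using hm.add (hlim.smul_const w)
  exact ge_of_tendsto' h4 fun n => h1 n θ

/-- The modulus `|x + i y| = sup_θ (cos θ • x + sin θ • y)` of an element of the complexification
of a real Banach lattice. -/
noncomputable def complexModulus [CompleteSpace X] (x y : X) : X :=
  Classical.choose (exists_isLUB_rotatedRe x y)

theorem isLUB_complexModulus [CompleteSpace X] (x y : X) :
    IsLUB (Set.range (rotatedRe x y)) (complexModulus x y) :=
  Classical.choose_spec (exists_isLUB_rotatedRe x y)

end RealBanachLattice

/-- A complex Banach lattice: a complex Banach space `E` which is the complexification `X + i X` of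
a real Banach lattice `X`, with the norm `‖x + i y‖ = ‖ |x + i y| ‖`, where the modulus is
`|x + i y| = sup_θ (cos θ • x + sin θ • y)`. The map `ofReal` identifies `X` with the real part
of `E`. -/
structure ComplexBanachLattice (X E : Type*)
    [NormedAddCommGroup X] [NormedSpace ℝ X] [CompleteSpace X] [Lattice X]
    [IsOrderedAddMonoid X] [IsOrderedModule ℝ X] [HasSolidNorm X]
    [NormedAddCommGroup E] [NormedSpace ℂ E] where
  ofReal : X →ₗ[ℝ] E
  existsUnique_re_im : ∀ z : E, ∃! p : X × X, z = ofReal p.1 + Complex.I • ofReal p.2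
  norm_eq : ∀ x y : X, ‖ofReal x + Complex.I • ofReal y‖ = ‖complexModulus x y‖

namespace ComplexBanachLattice

variable {X E : Type*}
  [NormedAddCommGroup X] [NormedSpace ℝ X] [CompleteSpace X] [Lattice X]
  [IsOrderedAddMonoid X] [IsOrderedModule ℝ X] [HasSolidNorm X]
  [NormedAddCommGroup E] [NormedSpace ℂ E]

/-- `0 ≤ f` in a complex Banach lattice: `f` is real and positive. -/
def Nonneg (L : ComplexBanachLattice X E) (f : E) : Prop :=
  ∃ x : X, 0 ≤ x ∧ L.ofReal x = f

/-- `T` is a positive operator: `T f ≥ 0` for each `f ≥ 0`. -/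
def IsPositiveOperator (L : ComplexBanachLattice X E) (T : E →L[ℂ] E) : Prop :=
  ∀ f : E, L.Nonneg f → L.Nonneg (T f)

/-- `T` is uniformly eventually positive: all sufficiently large powers of `T` are positive. -/
def IsUniformlyEventuallyPositive (L : ComplexBanachLattice X E) (T : E →L[ℂ] E) : Prop :=
  ∃ n₀ : ℕ, ∀ n : ℕ, n₀ ≤ n → L.IsPositiveOperator (T ^ n)

end ComplexBanachLattice

section SpectralTheory

variable {E : Type*} [NormedAddCommGroup E] [NormedSpace ℂ E]

/-- `μ` is a pole of order `k` of the resolvent `z ↦ (z - T)⁻¹` (in the use below, `1 ≤ k`). -/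
def IsResolventPoleOfOrder (T : E →L[ℂ] E) (μ : ℂ) (k : ℕ) : Prop :=
  MeromorphicAt (resolvent T) μ ∧ meromorphicOrderAt (resolvent T) μ = ((-(k : ℤ) : ℤ) : WithTop ℤ)

/-- The operator `(2πi)⁻¹ ∮ (z - T)⁻¹ dz`, integrated over the positively oriented circle with
centre `μ` and radius `r`. -/
noncomputable def circleProjection (T : E →L[ℂ] E) (μ : ℂ) (r : ℝ) : E →L[ℂ] E :=
  (2 * (Real.pi : ℂ) * Complex.I)⁻¹ • circleIntegral (fun z => resolvent T z) μ r

/-- `P` is the spectral projection of `T` associated with the isolated spectral value `μ`: it is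
given by the integral over a circle around `μ` that encloses no other point of the spectrum. (It
does not depend on the choice of the circle, by Cauchy's theorem.) -/
def IsSpectralProjection (T : E →L[ℂ] E) (μ : ℂ) (P : E →L[ℂ] E) : Prop :=
  ∃ r : ℝ, 0 < r ∧ spectrum ℂ T ∩ Metric.closedBall μ r = {μ} ∧ P = circleProjection T μ r

/-- `μ` is a Riesz point of `T`: a spectral value that is a pole of the resolvent and has a
finite-dimensional spectral space (the range of the spectral projection). -/
def IsRieszPoint (T : E →L[ℂ] E) (μ : ℂ) : Prop :=
  μ ∈ spectrum ℂ T ∧ (∃ k : ℕ, 1 ≤ k ∧ IsResolventPoleOfOrder T μ k) ∧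
    ∃ P : E →L[ℂ] E, IsSpectralProjection T μ P ∧
      FiniteDimensional ℂ (LinearMap.range (P : E →ₗ[ℂ] E))

/-- The spectral radius of `T` as a real number. -/
noncomputable def specRadius (T : E →L[ℂ] E) : ℝ := (spectralRadius ℂ T).toReal

end SpectralTheory

/-!
The proof compares the eigenspace `G = ker (μ - T)` with the range of the residue `P` of the
resolvent at the simple pole `r = r(T) > 0`. This residue is a projection onto `ker (r - T)`, which
has finite dimension because the spectral projection fixes it pointwise.

Abel summation of the Neumann series `∑ T ^ k / t ^ (k + 1)`, as `t` decreases to `r`, shows that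
`P f ≥ g` whenever `T ^ k f ≥ r ^ k g` for all large `k` (`nonneg_residue_apply_sub`). In
particular `P` is positive. If `T z = μ z`, then `r ^ k |z| = |T ^ k z| ≤ T ^ k |z|` for large `k`,
hence `|z| ≤ P |z|` for every `z` in `G`. What remains is a statement about lattices: a
complex subspace on which `|z| ≤ P |z|`, for a positive projection `P` of finite rank `d`, has
dimension at most `d` (`rank_le_of_modulus_le`).

The range of `P` is a vector lattice with positive part `x ↦ P x⁺`, and its lattice homomorphisms
separate its positive elements from `0`: they arise as the extreme points of a compact base of the
dual cone, where the Hahn-Banach theorem yields the homomorphism property and the Krein-Milman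
theorem yields enough of them. At most `d` linearly independent ones span them all
(`exists_finset_latticeFunctionals`).

For such a homomorphism `φ`, extended by `φ ∘ P = φ`, the inequality `|z| ≤ P |z|` makes `|z|` a
multiple of one fixed vector `e` modulo the null space of `φ`. Suppose that `|z| = |w| = e` in this
sense. Were `z` and `w` functions, `z - α w` would vanish at a point for a suitable unimodular `α`,
and its modulus, a multiple of `e`, would vanish everywhere. Without function representations, this
is the inequality `|c z - e| ≤ K (e - Re (c z)) + δ e` (`modulus_smul_sub_ofReal_le`), in which one
takes suprema over `c`. So the seminorm `z ↦ φ |z|` vanishes on a subspace of codimension at most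
one in `G`. The intersection of these at most `d` subspaces is `0`, since there `|z| ≤ P |z| = 0`.
-/

set_option linter.unusedSectionVars false

namespace ComplexBanachLattice

variable {X E : Type*}
  [NormedAddCommGroup X] [NormedSpace ℝ X] [CompleteSpace X] [Lattice X]
  [IsOrderedAddMonoid X] [IsOrderedModule ℝ X] [HasSolidNorm X]
  [NormedAddCommGroup E] [NormedSpace ℂ E] (L : ComplexBanachLattice X E)

/-! ### Real parts and moduli in a complex Banach lattice -/

/-- The imaginary part of an element of a complex Banach lattice. -/
noncomputable def im (z : E) : X := (L.existsUnique_re_im z).choose.2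

theorem eq_re_im_of_eq {z : E} {x y : X} (h : z = L.ofReal x + Complex.I • L.ofReal y) :
    (L.existsUnique_re_im z).choose.1 = x ∧ L.im z = y := by
  have h1 := (L.existsUnique_re_im z).choose_spec.2 (x, y) h
  exact ⟨congrArg Prod.fst h1.symm, congrArg Prod.snd h1.symm⟩

/-- The real part of an element of a complex Banach lattice, as a real-linear map. -/
noncomputable def re : E →ₗ[ℝ] X where
  toFun z := (L.existsUnique_re_im z).choose.1
  map_add' z w := by
    refine (L.eq_re_im_of_eq (y := L.im z + L.im w) ?_).1
    have hz := (L.existsUnique_re_im z).choose_spec.1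
    have hw := (L.existsUnique_re_im w).choose_spec.1
    conv_lhs => rw [hz, hw]
    simp only [map_add, im]
    module
  map_smul' a z := by
    refine (L.eq_re_im_of_eq (y := a • L.im z) ?_).1
    have hz := (L.existsUnique_re_im z).choose_spec.1
    conv_lhs => rw [hz]
    simp only [map_smul, im, RingHom.id_apply, smul_add, smul_comm a Complex.I]

theorem ofReal_re_add_I_smul_ofReal_im (z : E) :
    L.ofReal (L.re z) + Complex.I • L.ofReal (L.im z) = z :=
  ((L.existsUnique_re_im z).choose_spec.1).symm

theorem re_eq_of_eq {z : E} {x y : X} (h : z = L.ofReal x + Complex.I • L.ofReal y) :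
    L.re z = x := (L.eq_re_im_of_eq h).1

@[simp] theorem re_ofReal (x : X) : L.re (L.ofReal x) = x :=
  L.re_eq_of_eq (y := 0) (by simp)

theorem re_smul (c : ℂ) (z : E) : L.re (c • z) = c.re • L.re z - c.im • L.im z := by
  apply L.re_eq_of_eq (y := c.re • L.im z + c.im • L.re z)
  conv_lhs => rw [← L.ofReal_re_add_I_smul_ofReal_im z]
  simp only [map_add, map_sub, map_smul, ← Complex.coe_smul, smul_add, smul_smul]
  match_scalars
  · linear_combination (-1 : ℂ) * Complex.re_add_im c
  · linear_combination (-Complex.I) * Complex.re_add_im c + (c.im : ℂ) * Complex.I_mul_I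

theorem re_smul_ofReal (c : ℂ) (x : X) : L.re (c • L.ofReal x) = c.re • x := by
  have h : L.im (L.ofReal x) = 0 := (L.eq_re_im_of_eq (x := x) (by simp)).2
  rw [re_smul, re_ofReal, h, smul_zero, sub_zero]

theorem im_eq_neg_re_I_smul (z : E) : L.im z = -L.re (Complex.I • z) := by
  simp [re_smul]

/-- The modulus `|z|` of an element of a complex Banach lattice. -/
noncomputable def modulus (z : E) : X := complexModulus (L.re z) (L.im z)

theorem rotatedRe_re_im (z : E) (θ : ℝ) :
    rotatedRe (L.re z) (L.im z) θ = L.re (Complex.exp ((-θ : ℝ) * Complex.I) • z) := by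
  rw [re_smul, Complex.exp_ofReal_mul_I_re, Complex.exp_ofReal_mul_I_im, rotatedRe]
  simp

theorem modulus_le_iff {z : E} {b : X} :
    L.modulus z ≤ b ↔ ∀ c : ℂ, ‖c‖ = 1 → L.re (c • z) ≤ b := by
  refine (isLUB_le_iff (isLUB_complexModulus _ _)).trans
    ⟨fun h c hc => ?_, fun h => ?_⟩
  · have h1 := h ⟨-c.arg, rfl⟩
    rw [rotatedRe_re_im, neg_neg] at h1
    have h2 := Complex.norm_mul_exp_arg_mul_I c
    rw [hc, Complex.ofReal_one, one_mul] at h2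
    rwa [h2] at h1
  · rintro _ ⟨θ, rfl⟩
    rw [rotatedRe_re_im]
    exact h _ (Complex.norm_exp_ofReal_mul_I _)

theorem re_smul_le_modulus {c : ℂ} (hc : ‖c‖ = 1) (z : E) : L.re (c • z) ≤ L.modulus z :=
  L.modulus_le_iff.1 le_rfl c hc

theorem re_le_modulus (z : E) : L.re z ≤ L.modulus z := by
  simpa using L.re_smul_le_modulus norm_one z

theorem modulus_nonneg (z : E) : 0 ≤ L.modulus z := by
  have h1 := L.re_le_modulus z
  have h2 := L.re_smul_le_modulus (c := -1) (by simp) z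
  rw [neg_one_smul, map_neg] at h2
  have h3 := add_nonneg (sub_nonneg.2 h1) (sub_nonneg.2 h2)
  have h4 : (2 : ℝ) • L.modulus z = L.modulus z - L.re z + (L.modulus z - -L.re z) := by module
  rw [← h4] at h3
  simpa [smul_smul] using smul_nonneg (a := (1 / 2 : ℝ)) (by norm_num) h3

theorem modulus_smul_le (c : ℂ) (z : E) : L.modulus (c • z) ≤ ‖c‖ • L.modulus z := by
  rw [modulus_le_iff]
  intro d hd
  have h1 := Complex.norm_mul_exp_arg_mul_I c
  rw [← h1, smul_smul, mul_left_comm, mul_smul, Complex.coe_smul, map_smul, h1]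
  refine smul_le_smul_of_nonneg_left (L.re_smul_le_modulus ?_ z) (norm_nonneg c)
  rw [norm_mul, hd, Complex.norm_exp_ofReal_mul_I, one_mul]

theorem modulus_smul (c : ℂ) (z : E) : L.modulus (c • z) = ‖c‖ • L.modulus z := by
  refine le_antisymm (L.modulus_smul_le c z) ?_
  rcases eq_or_ne c 0 with rfl | hc
  · simpa using L.modulus_nonneg 0
  · have h := smul_le_smul_of_nonneg_left (L.modulus_smul_le c⁻¹ (c • z)) (norm_nonneg c)
    rwa [smul_smul, inv_mul_cancel₀ hc, one_smul, smul_smul, norm_inv,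
      mul_inv_cancel₀ (norm_ne_zero_iff.2 hc), one_smul] at h

theorem modulus_add_le (z w : E) : L.modulus (z + w) ≤ L.modulus z + L.modulus w := by
  rw [modulus_le_iff]
  intro c hc
  rw [smul_add, map_add]
  exact add_le_add (L.re_smul_le_modulus hc z) (L.re_smul_le_modulus hc w)

theorem modulus_zero : L.modulus 0 = 0 := by simpa using L.modulus_smul 0 0

theorem re_smul_le_norm_smul_modulus (c : ℂ) (z : E) : L.re (c • z) ≤ ‖c‖ • L.modulus z :=
  (L.re_le_modulus _).trans (L.modulus_smul_le c z)

theorem modulus_le_abs_add_abs (z : E) : L.modulus z ≤ |L.re z| + |L.im z| := by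
  have key : ∀ (a : ℝ) (v : X), |a| ≤ 1 → a • v ≤ |v| := by
    intro a v ha
    refine (le_abs_self _).trans ?_
    rw [abs_le']
    have h1 : |a| • |v| ≤ |v| := by
      simpa using smul_le_smul_of_nonneg_right ha (abs_nonneg v)
    have h2 : ∀ b : ℝ, b • v ≤ |b| • |v| := by
      intro b
      rcases le_total 0 b with h | h
      · rw [abs_of_nonneg h]
        exact smul_le_smul_of_nonneg_left (le_abs_self v) h
      · rw [abs_of_nonpos h, ← neg_smul_neg b v]
        exact smul_le_smul_of_nonneg_left (neg_le_abs v) (neg_nonneg.2 h)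
    refine ⟨(h2 a).trans h1, ?_⟩
    rw [← neg_smul]
    refine (h2 _).trans ?_
    rwa [abs_neg]
  rw [modulus_le_iff]
  intro c hc
  rw [re_smul, sub_eq_add_neg, ← neg_smul]
  refine add_le_add (key _ _ ((Complex.abs_re_le_norm c).trans hc.le)) (key _ _ ?_)
  rw [abs_neg]
  exact (Complex.abs_im_le_norm c).trans hc.le

theorem eq_zero_of_modulus_eq_zero {z : E} (h : L.modulus z = 0) : z = 0 := by
  have h1 := L.norm_eq (L.re z) (L.im z)
  rw [ofReal_re_add_I_smul_ofReal_im] at h1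
  rw [← norm_eq_zero, h1]
  exact norm_eq_zero.2 h

theorem modulus_ofReal (x : X) : L.modulus (L.ofReal x) = |x| := by
  refine le_antisymm ?_ (abs_le'.2 ⟨?_, ?_⟩)
  · simpa [im_eq_neg_re_I_smul, re_smul_ofReal] using L.modulus_le_abs_add_abs (L.ofReal x)
  · simpa using L.re_le_modulus (L.ofReal x)
  · simpa using L.re_smul_le_modulus (c := -1) (by simp) (L.ofReal x)

theorem norm_ofReal (x : X) : ‖L.ofReal x‖ = ‖x‖ := by
  have h1 := L.norm_eq x 0
  have h2 := L.modulus_ofReal x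
  rw [modulus, re_ofReal, im_eq_neg_re_I_smul, re_smul_ofReal, Complex.I_re, zero_smul,
    neg_zero] at h2
  rw [map_zero, smul_zero, add_zero, h2] at h1
  rw [h1, norm_abs_eq_norm]

theorem isometry_ofReal : Isometry L.ofReal :=
  AddMonoidHomClass.isometry_of_norm L.ofReal L.norm_ofReal

/-! ### The positive cone and positive operators -/

theorem nonneg_ofReal_iff {x : X} : L.Nonneg (L.ofReal x) ↔ 0 ≤ x := by
  refine ⟨?_, fun h => ⟨x, h, rfl⟩⟩
  rintro ⟨y, hy, h⟩
  rwa [← L.isometry_ofReal.injective h]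

theorem isClosed_nonneg : IsClosed {f : E | L.Nonneg f} :=
  L.isometry_ofReal.isClosedEmbedding.isClosedMap _ (isClosed_Ici (a := (0 : X)))

theorem nonneg_zero : L.Nonneg (0 : E) := ⟨0, le_rfl, map_zero _⟩

variable {L} in
theorem Nonneg.add {f g : E} (hf : L.Nonneg f) (hg : L.Nonneg g) : L.Nonneg (f + g) := by
  obtain ⟨x, hx, rfl⟩ := hf
  obtain ⟨y, hy, rfl⟩ := hg
  exact ⟨x + y, add_nonneg hx hy, map_add _ _ _⟩

variable {L} in
theorem Nonneg.smul {f : E} (hf : L.Nonneg f) {a : ℝ} (ha : 0 ≤ a) : L.Nonneg ((a : ℂ) • f) := by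
  obtain ⟨x, hx, rfl⟩ := hf
  exact ⟨a • x, smul_nonneg ha hx, by rw [map_smul, Complex.coe_smul]⟩

theorem nonneg_of_hasSum {u : ℕ → E} {f : E} (h : HasSum u f) (hu : ∀ n, L.Nonneg (u n)) :
    L.Nonneg f := by
  refine L.isClosed_nonneg.mem_of_tendsto h.tendsto_sum_nat (Filter.Eventually.of_forall fun n => ?_)
  refine Finset.sum_induction _ L.Nonneg (fun _ _ ha hb => ha.add hb) L.nonneg_zero
    (fun k _ => hu k)

variable {L} in
theorem IsPositiveOperator.ofReal_re {A : E →L[ℂ] E} (hA : L.IsPositiveOperator A) (x : X) :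
    L.ofReal (L.re (A (L.ofReal x))) = A (L.ofReal x) := by
  obtain ⟨a, -, ha⟩ := hA _ (L.nonneg_ofReal_iff.2 (posPart_nonneg x))
  obtain ⟨b, -, hb⟩ := hA _ (L.nonneg_ofReal_iff.2 (negPart_nonneg x))
  have h : A (L.ofReal x) = L.ofReal (a - b) := by
    rw [map_sub, ha, hb, ← map_sub, ← map_sub, posPart_sub_negPart]
  rw [h, re_ofReal]

variable {L} in
theorem IsPositiveOperator.re_apply_mono {A : E →L[ℂ] E} (hA : L.IsPositiveOperator A) {x y : X}
    (h : x ≤ y) : L.re (A (L.ofReal x)) ≤ L.re (A (L.ofReal y)) := by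
  obtain ⟨a, ha, hA'⟩ := hA _ (L.nonneg_ofReal_iff.2 (sub_nonneg.2 h))
  have h1 := congrArg L.re hA'
  rw [re_ofReal, map_sub, map_sub, map_sub] at h1
  rwa [← sub_nonneg, ← h1]

variable {L} in
theorem IsPositiveOperator.re_apply {A : E →L[ℂ] E} (hA : L.IsPositiveOperator A) (z : E) :
    L.re (A z) = L.re (A (L.ofReal (L.re z))) := by
  conv_lhs => rw [← L.ofReal_re_add_I_smul_ofReal_im z, map_add, map_smul, map_add,
    ← hA.ofReal_re (L.im z), re_smul_ofReal, Complex.I_re, zero_smul, add_zero]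

variable {L} in
/-- A positive operator satisfies `|A z| ≤ A |z|`. -/
theorem IsPositiveOperator.modulus_apply_le {A : E →L[ℂ] E} (hA : L.IsPositiveOperator A) (z : E) :
    L.modulus (A z) ≤ L.re (A (L.ofReal (L.modulus z))) := by
  rw [modulus_le_iff]
  intro c hc
  rw [← map_smul, hA.re_apply]
  exact hA.re_apply_mono (L.re_smul_le_modulus hc z)

end ComplexBanachLattice

/-! ### Lattice functionals on the range of a positive projection -/

section PositiveProjection

variable {X : Type*} [NormedAddCommGroup X] [NormedSpace ℝ X] [Lattice X]
  [IsOrderedAddMonoid X] [IsOrderedModule ℝ X]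

theorem posPart_add_le_add_posPart (x y : X) : (x + y)⁺ ≤ x⁺ + y⁺ :=
  sup_le (add_le_add (le_posPart x) (le_posPart y))
    (add_nonneg (posPart_nonneg x) (posPart_nonneg y))

theorem posPart_smul_of_pos {a : ℝ} (ha : 0 < a) (x : X) : (a • x)⁺ = a • x⁺ := by
  have key : ∀ (b : ℝ) (y : X), 0 < b → (b • y)⁺ ≤ b • y⁺ := fun b y hb =>
    sup_le (smul_le_smul_of_nonneg_left (le_posPart y) hb.le) (smul_nonneg hb.le (posPart_nonneg y))
  refine le_antisymm (key a x ha) ?_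
  have h := smul_le_smul_of_nonneg_left (key a⁻¹ (a • x) (inv_pos.2 ha)) ha.le
  rwa [smul_smul, inv_mul_cancel₀ ha.ne', one_smul, smul_smul, mul_inv_cancel₀ ha.ne',
    one_smul] at h

theorem map_mono_of_nonneg {φ : X →ₗ[ℝ] ℝ} (hφ : ∀ x, 0 ≤ x → 0 ≤ φ x) {x y : X} (h : x ≤ y) :
    φ x ≤ φ y := by
  have := hφ _ (sub_nonneg.2 h)
  rwa [map_sub, sub_nonneg] at this

variable {P : X →ₗ[ℝ] X}

/-- The positive functionals on the range of `P` that take the value `1` at `u`. If `u` is an order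
unit, this is a base of the dual of the positive cone. -/
def positiveBase (P : X →ₗ[ℝ] X) (u : LinearMap.range P) : Set (LinearMap.range P →L[ℝ] ℝ) :=
  {φ | (∀ v : LinearMap.range P, 0 ≤ (v : X) → 0 ≤ φ v) ∧ φ u = 1}

theorem convex_positiveBase (u : LinearMap.range P) : Convex ℝ (positiveBase P u) := by
  rintro φ ⟨hφ, hφu⟩ ψ ⟨hψ, hψu⟩ a b ha hb hab
  refine ⟨fun v hv => ?_, ?_⟩
  · exact add_nonneg (mul_nonneg ha (hφ v hv)) (mul_nonneg hb (hψ v hv))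
  · simp [hφu, hψu, hab]

theorem isClosed_positiveBase (u : LinearMap.range P) : IsClosed (positiveBase P u) := by
  have h : positiveBase P u = (⋂ (v : LinearMap.range P) (_ : 0 ≤ (v : X)), {φ | 0 ≤ φ v}) ∩
      {φ | φ u = 1} := by
    ext φ; simp [positiveBase]
  rw [h]
  refine IsClosed.inter (isClosed_iInter fun v => isClosed_iInter fun _ => ?_) ?_
  · exact isClosed_le continuous_const (ContinuousLinearMap.apply ℝ ℝ v).continuous
  · exact isClosed_eq (ContinuousLinearMap.apply ℝ ℝ u).continuous continuous_const

theorem apply_of_mem_range (hidem : ∀ x, P (P x) = P x) (v : LinearMap.range P) :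
    P v = v := by
  obtain ⟨x, hx⟩ := v.2
  rw [← hx, hidem]

/-- An order unit of the range of a positive projection is the image of the sum of the moduli of
the vectors of a basis. -/
theorem exists_orderUnit [FiniteDimensional ℝ (LinearMap.range P)]
    (hpos : ∀ x, 0 ≤ x → 0 ≤ P x) (hidem : ∀ x, P (P x) = P x) :
    ∃ u : LinearMap.range P, 0 ≤ (u : X) ∧
      ∀ i, |(Module.finBasis ℝ (LinearMap.range P) i : X)| ≤ u := by
  let b := Module.finBasis ℝ (LinearMap.range P)
  have hmono : ∀ {x y : X}, x ≤ y → P x ≤ P y := fun {x y} h => by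
    have := hpos _ (sub_nonneg.2 h)
    rwa [map_sub, sub_nonneg] at this
  have hsum : ∀ i, |(b i : X)| ≤ ∑ j, |(b j : X)| := fun i =>
    Finset.single_le_sum (f := fun j => |(b j : X)|) (fun j _ => abs_nonneg _) (Finset.mem_univ i)
  refine ⟨⟨P (∑ i, |(b i : X)|), LinearMap.mem_range_self _ _⟩,
    hpos _ (Finset.sum_nonneg fun i _ => abs_nonneg _), fun i => abs_le'.2 ⟨?_, ?_⟩⟩
  · rw [← apply_of_mem_range hidem (b i)]
    exact hmono ((le_abs_self _).trans (hsum i))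
  · rw [← apply_of_mem_range hidem (b i), ← map_neg]
    exact hmono ((neg_le_abs _).trans (hsum i))

theorem abs_apply_le_of_abs_le {φ : LinearMap.range P →ₗ[ℝ] ℝ}
    (hφ : ∀ v : LinearMap.range P, 0 ≤ (v : X) → 0 ≤ φ v) {v u : LinearMap.range P}
    (h : |(v : X)| ≤ u) : |φ v| ≤ φ u := by
  rw [abs_le', ← map_neg]
  rw [abs_le'] at h
  constructor
  · have := hφ (u - v) (by simpa using h.1)
    rwa [map_sub, sub_nonneg] at this
  · have := hφ (u - -v) (by simpa using neg_le_iff_add_nonneg.1 h.2)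
    rwa [map_sub, sub_nonneg] at this

section OrderUnit

variable [FiniteDimensional ℝ (LinearMap.range P)] {u : LinearMap.range P}
  (hu : ∀ i, |(Module.finBasis ℝ (LinearMap.range P) i : X)| ≤ u)

include hu

theorem eq_zero_of_apply_orderUnit_eq_zero {φ : LinearMap.range P →ₗ[ℝ] ℝ}
    (hφ : ∀ v : LinearMap.range P, 0 ≤ (v : X) → 0 ≤ φ v) (h : φ u = 0) : φ = 0 := by
  refine (Module.finBasis ℝ (LinearMap.range P)).ext fun i => ?_
  have h1 := abs_apply_le_of_abs_le hφ (hu i)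
  rw [h] at h1
  simpa using h1

theorem isCompact_positiveBase : IsCompact (positiveBase P u) := by
  have : ProperSpace (LinearMap.range P →L[ℝ] ℝ) :=
    FiniteDimensional.proper ℝ (LinearMap.range P →L[ℝ] ℝ)
  refine Metric.isCompact_of_isClosed_isBounded (α := LinearMap.range P →L[ℝ] ℝ)
    (isClosed_positiveBase u) ?_
  refine isBounded_iff_forall_norm_le.2 ⟨_, fun φ hφ =>
    (Module.finBasis ℝ (LinearMap.range P)).opNorm_le zero_le_one fun i => ?_⟩
  have h1 := abs_apply_le_of_abs_le (φ := (φ : LinearMap.range P →ₗ[ℝ] ℝ)) hφ.1 (hu i)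
  simpa [hφ.2] using h1

/-- Below an extreme point of the base of the dual cone there are only its multiples. -/
theorem eq_smul_of_mem_extremePoints {φ : LinearMap.range P →L[ℝ] ℝ}
    (hφ : φ ∈ Set.extremePoints ℝ (positiveBase P u)) {ψ : LinearMap.range P →ₗ[ℝ] ℝ}
    (hψ : ∀ v : LinearMap.range P, 0 ≤ (v : X) → 0 ≤ ψ v)
    (hle : ∀ v : LinearMap.range P, 0 ≤ (v : X) → ψ v ≤ φ v) (hu0 : 0 ≤ (u : X)) :
    ∀ v, ψ v = ψ u * φ v := by
  have h0 : 0 ≤ ψ u := hψ u hu0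
  have h1 : ψ u ≤ 1 := (hle u hu0).trans_eq hφ.1.2
  rcases h0.eq_or_lt with h0 | h0
  · intro v
    rw [eq_zero_of_apply_orderUnit_eq_zero hu hψ h0.symm]
    simp
  rcases h1.eq_or_lt with h1 | h1
  · have h2 := eq_zero_of_apply_orderUnit_eq_zero hu
      (φ := (φ : LinearMap.range P →ₗ[ℝ] ℝ) - ψ)
      (fun v hv => sub_nonneg.2 (hle v hv)) (by simp [hφ.1.2, h1])
    intro v
    have h3 := congrArg (fun f => f v) h2
    simp only [LinearMap.sub_apply, LinearMap.zero_apply, sub_eq_zero] at h3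
    rw [h1, one_mul, ← h3]
    rfl
  · have hs : 0 < 1 - ψ u := sub_pos.2 h1
    have ha : (ψ u)⁻¹ • ψ.toContinuousLinearMap ∈ positiveBase P u :=
      ⟨fun v hv => mul_nonneg (inv_nonneg.2 h0.le) (hψ v hv), inv_mul_cancel₀ h0.ne'⟩
    have hb : (1 - ψ u)⁻¹ • (φ - ψ.toContinuousLinearMap) ∈ positiveBase P u := by
      refine ⟨fun v hv => mul_nonneg (inv_nonneg.2 hs.le) (sub_nonneg.2 (hle v hv)), ?_⟩
      change (1 - ψ u)⁻¹ * (φ u - ψ u) = 1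
      rw [hφ.1.2, inv_mul_cancel₀ hs.ne']
    have h2 := (mem_extremePoints.1 hφ).2 _ ha _ hb
      ⟨ψ u, 1 - ψ u, h0, hs, by ring, by
        rw [smul_smul, smul_smul, mul_inv_cancel₀ h0.ne', mul_inv_cancel₀ hs.ne']
        module⟩
    intro v
    have h3 := congrArg (fun f => f v) h2.1
    change (ψ u)⁻¹ * ψ v = φ v at h3
    rw [← h3, mul_inv_cancel_left₀ h0.ne']

/-- The extreme points of the base of the dual cone are lattice homomorphisms on the range of `P`,
whose positive part operation is `v ↦ P v⁺`. By the Hahn-Banach theorem there is a functional below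
the sublinear map `v ↦ φ (P v⁺)` which agrees with it at a given `v`. It is positive and below `φ`,
hence a multiple of `φ`. -/
theorem apply_posPart_of_mem_extremePoints (hpos : ∀ x, 0 ≤ x → 0 ≤ P x)
    (hidem : ∀ x, P (P x) = P x) (hu0 : 0 ≤ (u : X)) {φ : LinearMap.range P →L[ℝ] ℝ}
    (hφ : φ ∈ Set.extremePoints ℝ (positiveBase P u)) (v : LinearMap.range P) :
    φ (P.rangeRestrict (v : X)⁺) = (φ v)⁺ := by
  have hmono : ∀ x y : X, x ≤ y → φ (P.rangeRestrict x) ≤ φ (P.rangeRestrict y) := by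
    intro x y h
    have := hφ.1.1 (P.rangeRestrict (y - x)) (hpos _ (sub_nonneg.2 h))
    rwa [map_sub, map_sub, sub_nonneg] at this
  have hself : ∀ w : LinearMap.range P, P.rangeRestrict (w : X) = w := fun w =>
    Subtype.ext (apply_of_mem_range hidem w)
  have hge : ∀ w : LinearMap.range P, φ w ≤ φ (P.rangeRestrict (w : X)⁺) := fun w => by
    conv_lhs => rw [← hself w]
    exact hmono _ _ (le_posPart _)
  have hnonneg : ∀ w : LinearMap.range P, 0 ≤ φ (P.rangeRestrict (w : X)⁺) := fun w =>
    hφ.1.1 _ (hpos _ (posPart_nonneg _))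
  refine le_antisymm ?_ (sup_le (hge v) (hnonneg v))
  rcases eq_or_ne v 0 with rfl | hv
  · simp
  have hsmul : ∀ c : ℝ, 0 < c → ∀ w : LinearMap.range P,
      φ (P.rangeRestrict ((c • w : LinearMap.range P) : X)⁺) =
        c * φ (P.rangeRestrict (w : X)⁺) := by
    intro c hc w
    rw [Submodule.coe_smul, posPart_smul_of_pos hc, map_smul, map_smul, smul_eq_mul]
  obtain ⟨ψ, hψ, hψle⟩ := exists_extension_of_le_sublinear
    (LinearPMap.mkSpanSingleton (K := ℝ) v (φ (P.rangeRestrict (v : X)⁺)) hv)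
    (fun w : LinearMap.range P => φ (P.rangeRestrict (w : X)⁺)) hsmul
    (fun w w' => by
      rw [← map_add, ← map_add]
      exact hmono _ _ (posPart_add_le_add_posPart _ _))
    (by
      rintro ⟨w, hw⟩
      obtain ⟨c, rfl⟩ := Submodule.mem_span_singleton.1 hw
      refine (LinearPMap.mkSpanSingleton'_apply v _ _ c hw).trans_le ?_
      rw [RingHom.id_apply, smul_eq_mul]
      rcases lt_or_ge 0 c with hc | hc
      · exact (hsmul c hc v).ge
      · exact (mul_nonpos_of_nonpos_of_nonneg hc (hnonneg v)).trans (hnonneg _))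
  have hψv : ψ v = φ (P.rangeRestrict (v : X)⁺) := by
    have h := hψ ⟨v, Submodule.mem_span_singleton_self v⟩
    rw [h]
    exact (LinearPMap.mkSpanSingleton_apply ℝ ℝ hv _)
  have hψ0 : ∀ w : LinearMap.range P, 0 ≤ (w : X) → 0 ≤ ψ w := by
    intro w hw
    have h := hψle (-w)
    rw [map_neg, Submodule.coe_neg, posPart_eq_zero.2 (neg_nonpos.2 hw), map_zero, map_zero] at h
    linarith
  have hψφ : ∀ w : LinearMap.range P, 0 ≤ (w : X) → ψ w ≤ φ w := by
    intro w hw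
    have h := hψle w
    rwa [posPart_eq_self.2 hw, hself] at h
  have hmul := eq_smul_of_mem_extremePoints hu hφ hψ0 hψφ hu0 v
  have h0 : 0 ≤ ψ u := hψ0 u hu0
  have h1 : ψ u ≤ 1 := (hψφ u hu0).trans_eq hφ.1.2
  rw [← hψv, hmul]
  exact (mul_le_mul_of_nonneg_left (le_posPart _) h0).trans
    (mul_le_of_le_one_left (posPart_nonneg _) h1)

/-- By the Krein-Milman theorem, the extreme points of the base of the dual cone detect whether a
positive element of the range of `P` vanishes. -/
theorem eq_zero_of_forall_extremePoints [HasSolidNorm X] {v : LinearMap.range P} (hv : 0 ≤ (v : X))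
    (h : ∀ φ ∈ Set.extremePoints ℝ (positiveBase P u), φ v = 0) : v = 0 := by
  have hB : ∀ φ ∈ positiveBase P u, φ v = 0 := by
    intro φ hφ
    rw [← closure_convexHull_extremePoints (isCompact_positiveBase hu) (convex_positiveBase u)] at hφ
    have hc : IsClosed {φ : LinearMap.range P →L[ℝ] ℝ | φ v = 0} :=
      isClosed_eq (ContinuousLinearMap.apply ℝ ℝ v).continuous continuous_const
    refine closure_minimal (convexHull_min h ?_) hc hφ
    rintro φ hφ ψ hψ a b - - -
    change a * φ v + b * ψ v = 0
    rw [show φ v = 0 from hφ, show ψ v = 0 from hψ, mul_zero, mul_zero, add_zero]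
  by_contra hne
  have hcone : Convex ℝ {w : LinearMap.range P | 0 ≤ (w : X)} := by
    rintro w hw w' hw' a b ha hb -
    exact add_nonneg (smul_nonneg ha hw) (smul_nonneg hb hw')
  have hclosed : IsClosed {w : LinearMap.range P | 0 ≤ (w : X)} :=
    isClosed_le continuous_const continuous_subtype_val
  have hnot : -v ∉ {w : LinearMap.range P | 0 ≤ (w : X)} := fun h =>
    hne (Subtype.ext (le_antisymm (neg_nonneg.1 h) hv))
  obtain ⟨g, s, hgs, hg⟩ := geometric_hahn_banach_point_closed hcone hclosed hnot
  have hs : s < 0 := by simpa using hg 0 (le_refl (0 : X))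
  have hg0 : ∀ w : LinearMap.range P, 0 ≤ (w : X) → 0 ≤ g w := by
    intro w hw
    by_contra! hneg
    have h1 := hg ((s / g w) • w) (smul_nonneg (div_nonneg_of_nonpos hs.le hneg.le) hw)
    rw [map_smul, smul_eq_mul, div_mul_cancel₀ _ hneg.ne] at h1
    exact h1.false
  have hgv : 0 < g v := by
    rw [map_neg] at hgs
    linarith
  have hu0 : 0 ≤ g u := by
    have hbasis : (Module.finBasis ℝ (LinearMap.range P)).equivFun v ≠ 0 := by simpa using hne
    obtain ⟨i, -⟩ := Function.ne_iff.1 hbasis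
    exact hg0 u ((abs_nonneg _).trans (hu i))
  rcases hu0.eq_or_lt with h0 | h0
  · have h1 := eq_zero_of_apply_orderUnit_eq_zero hu
      (φ := (g : LinearMap.range P →ₗ[ℝ] ℝ)) hg0 h0.symm
    exact hgv.ne' (congrArg (fun f => f v) h1)
  · have h1 := hB ((g u)⁻¹ • g) ⟨fun w hw => mul_nonneg (inv_nonneg.2 h0.le) (hg0 w hw),
      inv_mul_cancel₀ h0.ne'⟩
    change (g u)⁻¹ * g v = 0 at h1
    exact (mul_pos (inv_pos.2 h0) hgv).ne' h1

end OrderUnit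

/-- The range of a positive projection `P` of finite rank carries at most `dim (range P)` lattice
homomorphisms that together detect whether a positive element vanishes. They are given here through
their compositions with `P`. -/
theorem exists_finset_latticeFunctionals [HasSolidNorm X]
    [FiniteDimensional ℝ (LinearMap.range P)]
    (hpos : ∀ x, 0 ≤ x → 0 ≤ P x) (hidem : ∀ x, P (P x) = P x) :
    ∃ S : Finset (X →ₗ[ℝ] ℝ), S.card ≤ Module.finrank ℝ (LinearMap.range P) ∧
      (∀ φ ∈ S, (∀ x, 0 ≤ x → 0 ≤ φ x) ∧ (∀ x, φ (P x) = φ x) ∧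
        ∀ x, φ (P x)⁺ = (φ x)⁺) ∧
      ∀ x, 0 ≤ x → (∀ φ ∈ S, φ x = 0) → P x = 0 := by
  classical
  obtain ⟨u, hu0, hu⟩ := exists_orderUnit hpos hidem
  obtain ⟨B, hBsub, hBspan, hBli⟩ :=
    exists_linearIndependent ℝ (Set.extremePoints ℝ (positiveBase P u))
  have hBfin : B.Finite := hBli.setFinite
  have hcard : hBfin.toFinset.card ≤ Module.finrank ℝ (LinearMap.range P) := by
    have : Fintype B := hBfin.fintype
    have h1 := hBli.fintype_card_le_finrank
    rw [← Subspace.dual_finrank_eq (K := ℝ) (V := LinearMap.range P),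
      (LinearMap.toContinuousLinearMap (𝕜 := ℝ) (E := LinearMap.range P) (F' := ℝ)).finrank_eq]
    rwa [Set.Finite.card_toFinset]
  let F : (LinearMap.range P →L[ℝ] ℝ) → X →ₗ[ℝ] ℝ := fun φ =>
    (φ : LinearMap.range P →ₗ[ℝ] ℝ) ∘ₗ P.rangeRestrict
  have hF : ∀ φ x, F φ x = φ (P.rangeRestrict x) := fun _ _ => rfl
  have hPP : ∀ x, P.rangeRestrict (P x) = P.rangeRestrict x := fun x => Subtype.ext (hidem x)
  refine ⟨hBfin.toFinset.image F, Finset.card_image_le.trans hcard, ?_, ?_⟩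
  · intro ψ hψ
    obtain ⟨φ, hφ, rfl⟩ := Finset.mem_image.1 hψ
    have hφ' := hBsub (hBfin.mem_toFinset.1 hφ)
    refine ⟨fun x hx => hφ'.1.1 _ (hpos x hx), fun x => ?_, fun x => ?_⟩
    · rw [hF, hF, hPP]
    · exact apply_posPart_of_mem_extremePoints hu hpos hidem hu0 hφ' (P.rangeRestrict x)
  · intro x hx h
    have h1 : P.rangeRestrict x = 0 := by
      refine eq_zero_of_forall_extremePoints hu (hpos x hx) fun φ hφ => ?_
      have h2 : φ ∈ Submodule.span ℝ B := hBspan ▸ Submodule.subset_span hφ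
      clear hφ
      induction h2 using Submodule.span_induction with
      | mem ψ hψ => exact h (F ψ) (Finset.mem_image_of_mem F (hBfin.mem_toFinset.2 hψ))
      | zero => rfl
      | add a b _ _ ha hb => rw [add_apply, ha, hb, add_zero]
      | smul c a _ ha => rw [smul_apply, ha, smul_zero]
    exact congrArg Subtype.val h1

end PositiveProjection

/-! ### Inequalities modulo the null space of a positive functional -/

/-- `a ≤ b` up to a positive error which is annihilated by `φ`. -/
def NullLE {X : Type*} [NormedAddCommGroup X] [NormedSpace ℝ X] [Lattice X] (φ : X →ₗ[ℝ] ℝ)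
    (a b : X) : Prop :=
  ∃ n, 0 ≤ n ∧ φ n = 0 ∧ a ≤ b + n

namespace NullLE

variable {X : Type*} [NormedAddCommGroup X] [NormedSpace ℝ X] [Lattice X]
  [IsOrderedAddMonoid X] [IsOrderedModule ℝ X] {φ : X →ₗ[ℝ] ℝ} {a b c : X}

theorem of_le (h : a ≤ b) : NullLE φ a b := ⟨0, le_rfl, map_zero φ, by simpa⟩

theorem trans (h₁ : NullLE φ a b) (h₂ : NullLE φ b c) : NullLE φ a c := by
  obtain ⟨n, hn, hn', h⟩ := h₁
  obtain ⟨k, hk, hk', h'⟩ := h₂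
  refine ⟨k + n, add_nonneg hk hn, by rw [map_add, hn', hk', add_zero], h.trans ?_⟩
  rw [← add_assoc]
  exact add_le_add h' le_rfl

/-- Moving terms across the inequality: only the difference of the two sides matters, up to a
nonnegative factor. -/
theorem rearrange (h : NullLE φ a b) {t : ℝ} (ht : 0 ≤ t) {a' b' : X}
    (e : b' - a' = t • (b - a)) : NullLE φ a' b' := by
  obtain ⟨n, hn, hn', h⟩ := h
  refine ⟨t • n, smul_nonneg ht hn, by rw [map_smul, hn', smul_zero], ?_⟩
  have h1 := smul_nonneg ht (sub_nonneg.2 h)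
  rw [← sub_nonneg]
  have h2 : b' + t • n - a' = t • (b + n - a) := by
    rw [add_sub_right_comm, e]
    module
  rwa [h2]

theorem apply_le (hφ : ∀ x, 0 ≤ x → 0 ≤ φ x) (h : NullLE φ a b) : φ a ≤ φ b := by
  obtain ⟨n, hn, hn', h⟩ := h
  have h1 := map_mono_of_nonneg hφ h
  rwa [map_add, hn', add_zero] at h1

end NullLE

namespace ComplexBanachLattice

variable {X E : Type*}
  [NormedAddCommGroup X] [NormedSpace ℝ X] [CompleteSpace X] [Lattice X]
  [IsOrderedAddMonoid X] [IsOrderedModule ℝ X] [HasSolidNorm X]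
  [NormedAddCommGroup E] [NormedSpace ℂ E] (L : ComplexBanachLattice X E)
  {φ : X →ₗ[ℝ] ℝ}

/-- The modulus remains a least upper bound modulo the null space of `φ`, although `φ` need not be
order continuous: finitely many rotations approximate the supremum uniformly. -/
theorem nullLE_modulus (hφ : ∀ x, 0 ≤ x → 0 ≤ φ x) {z : E} {b : X}
    (h : ∀ c : ℂ, ‖c‖ = 1 → NullLE φ (L.re (c • z)) b) : NullLE φ (L.modulus z) b := by
  choose! n hn hn' hle using h
  refine ⟨(L.modulus z - b)⁺, posPart_nonneg _, ?_, ?_⟩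
  · refine le_antisymm (le_of_forall_pos_le_add fun ε hε => ?_) (hφ _ (posPart_nonneg _))
    rw [zero_add]
    have hM : 0 ≤ φ (L.modulus z) := hφ _ (L.modulus_nonneg z)
    set δ : ℝ := ε / (φ (L.modulus z) + 1) with hδ
    have hδ0 : 0 < δ := by positivity
    have hδε : δ * φ (L.modulus z) ≤ ε := by
      rw [hδ, div_mul_eq_mul_div, div_le_iff₀ (by positivity)]
      nlinarith
    obtain ⟨t, htsub, htfin, ht⟩ := (isCompact_sphere (0 : ℂ) 1).finite_cover_balls hδ0
    have htn : ∀ c ∈ htfin.toFinset, ‖c‖ = 1 := fun c hc => by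
      simpa using htsub (htfin.mem_toFinset.1 hc)
    set N : X := ∑ c ∈ htfin.toFinset, n c with hN
    have hN0 : 0 ≤ N := Finset.sum_nonneg fun c hc => hn c (htn c hc)
    have hφN : φ N = 0 := by
      rw [hN, map_sum]
      exact Finset.sum_eq_zero fun c hc => hn' c (htn c hc)
    have hbound : L.modulus z ≤ b + (N + δ • L.modulus z) := by
      rw [modulus_le_iff]
      intro c hc
      obtain ⟨d, hd, hcd⟩ := Set.mem_iUnion₂.1 (ht (mem_sphere_zero_iff_norm.2 hc))
      have hd' := htfin.mem_toFinset.2 hd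
      have h1 : L.re (c • z) = L.re (d • z) + L.re ((c - d) • z) := by
        rw [← map_add, ← add_smul, add_sub_cancel]
      have h2 : L.re ((c - d) • z) ≤ δ • L.modulus z :=
        (L.re_smul_le_norm_smul_modulus _ _).trans
          (smul_le_smul_of_nonneg_right (by rw [← dist_eq_norm]; exact (Metric.mem_ball.1 hcd).le)
            (L.modulus_nonneg z))
      have h3 : n d ≤ N :=
        Finset.single_le_sum (f := n) (fun c hc => hn c (htn c hc)) hd'
      rw [h1, ← add_assoc]
      exact add_le_add ((hle d (htn d hd')).trans (add_le_add le_rfl h3)) h2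
    have h4 : (L.modulus z - b)⁺ ≤ N + δ • L.modulus z :=
      sup_le (sub_le_iff_le_add'.2 hbound)
        (add_nonneg hN0 (smul_nonneg hδ0.le (L.modulus_nonneg z)))
    have h5 := map_mono_of_nonneg hφ h4
    rw [map_add, hφN, zero_add, map_smul, smul_eq_mul] at h5
    exact h5.trans hδε
  · rw [← sub_le_iff_le_add']
    exact le_posPart _

/-- If `|z| ≤ e`, then the distance of `c z` to `e`, for `‖c‖ = 1`, is controlled by the gap
`e - Re (c z)` alone, up to an arbitrarily small multiple of `e`. -/
theorem modulus_smul_sub_ofReal_le {δ : ℝ} (hδ : 0 < δ) (hδ1 : δ ≤ 1) :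
    ∃ K : ℝ, 0 < K ∧ ∀ (z : E) (e : X), L.modulus z ≤ e → ∀ c : ℂ, ‖c‖ = 1 →
      L.modulus (c • z - L.ofReal e) ≤ K • (e - L.re (c • z)) + δ • e := by
  -- rotating `c z` by the angle `± δ` bounds its imaginary part, since `(1 - cos δ) / sin δ ≤ δ`
  have hs : δ / 2 ≤ Real.sin δ := by
    have h1 := Real.sin_gt_sub_cube hδ
    have h2 : δ ^ 3 ≤ δ := pow_le_of_le_one hδ.le hδ1 (by norm_num)
    linarith
  have hs0 : 0 < Real.sin δ := lt_of_lt_of_le (by positivity) hs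
  have hc : 1 - Real.cos δ ≤ Real.sin δ * δ := by
    nlinarith [Real.one_sub_sq_div_two_le_cos (x := δ)]
  refine ⟨1 + (Real.sin δ)⁻¹, by positivity, fun z e hz c hcn => ?_⟩
  have he : 0 ≤ e := (L.modulus_nonneg z).trans hz
  set y := c • z with hy
  have hye : L.modulus y ≤ e := by rwa [hy, modulus_smul, hcn, one_smul]
  have hue : L.re y ≤ e := (L.re_le_modulus y).trans hye
  have hrot : ∀ η : ℝ, Real.cos η • L.re y - Real.sin η • L.im y ≤ e := by
    intro η
    have h := (L.re_smul_le_modulus (Complex.norm_exp_ofReal_mul_I η) y).trans hye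
    rwa [re_smul, Complex.exp_ofReal_mul_I_re, Complex.exp_ofReal_mul_I_im] at h
  have key : ∀ v : X, Real.cos δ • L.re y + Real.sin δ • v ≤ e →
      v ≤ (Real.sin δ)⁻¹ • (e - L.re y) + δ • e := by
    intro v hv
    have h1 : Real.sin δ • v ≤ (e - L.re y) + (Real.sin δ * δ) • e := by
      have h2 : (1 - Real.cos δ) • L.re y ≤ (Real.sin δ * δ) • e :=
        (smul_le_smul_of_nonneg_left hue (sub_nonneg.2 (Real.cos_le_one δ))).trans
          (smul_le_smul_of_nonneg_right hc he)
      have h3 := add_le_add hv h2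
      rw [← sub_nonneg] at h3 ⊢
      convert h3 using 1
      module
    have h4 := smul_le_smul_of_nonneg_left h1 (inv_nonneg.2 hs0.le)
    rwa [smul_smul, inv_mul_cancel₀ hs0.ne', one_smul, smul_add, smul_smul,
      inv_mul_cancel_left₀ hs0.ne'] at h4
  have him : |L.im y| ≤ (Real.sin δ)⁻¹ • (e - L.re y) + δ • e := by
    refine abs_le'.2 ⟨key _ ?_, key _ ?_⟩
    · simpa using hrot (-δ)
    · simpa [sub_eq_add_neg] using hrot δ
  refine (L.modulus_le_abs_add_abs _).trans ?_
  have hre : L.re (y - L.ofReal e) = L.re y - e := by rw [map_sub, re_ofReal]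
  have him' : L.im (y - L.ofReal e) = L.im y := by
    rw [im_eq_neg_re_I_smul, smul_sub, map_sub, re_smul_ofReal, Complex.I_re, zero_smul, sub_zero,
      ← im_eq_neg_re_I_smul]
  rw [hre, him', abs_of_nonpos (sub_nonpos.2 hue), neg_sub, add_smul, one_smul, add_assoc]
  exact add_le_add le_rfl him

/-- If `|z| = |w| = e` modulo the null space of `φ`, then `|z - α w|` cannot be bounded below by a
positive multiple of `e` uniformly in `α` on the unit circle. For functions this is clear at a
single point, with `α` the quotient of the values there. -/
theorem le_zero_of_forall_nullLE_modulus_sub (hφ : ∀ x, 0 ≤ x → 0 ≤ φ x) {e : X}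
    (hφe : φ e = 1) {z w : E} (hz : NullLE φ (L.modulus z) e) (hz' : NullLE φ e (L.modulus z))
    (hw : NullLE φ (L.modulus w) e) (hw' : NullLE φ e (L.modulus w)) {κ : ℝ}
    (h : ∀ α : ℂ, ‖α‖ = 1 → NullLE φ (κ • e) (L.modulus (z - α • w))) : κ ≤ 0 := by
  -- `|c z - d w| ≤ |c z - e| + |d w - e|`; then take the supremum over `c` and over `d` in turn
  have main : ∀ δ : ℝ, 0 < δ → δ ≤ 1 → κ ≤ 2 * δ := by
    intro δ hδ hδ1
    obtain ⟨K, hK, hdist⟩ := L.modulus_smul_sub_ofReal_le hδ hδ1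
    obtain ⟨n, hn, hn', hzn⟩ := hz
    obtain ⟨k, hk, hk', hwk⟩ := hw
    have h1 : ∀ c d : ℂ, ‖c‖ = 1 → ‖d‖ = 1 → NullLE φ (κ • e)
        (K • (e - L.re (c • z)) + K • (e - L.re (d • w)) + (2 * δ) • e) := by
      intro c d hc hd
      have hc0 : c ≠ 0 := norm_ne_zero_iff.1 (by rw [hc]; exact one_ne_zero)
      have h2 := h (c⁻¹ * d) (by rw [norm_mul, norm_inv, hc, hd]; norm_num)
      have h3 : L.modulus (z - (c⁻¹ * d) • w) = L.modulus (c • z - d • w) := by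
        have : c • z - d • w = c • (z - (c⁻¹ * d) • w) := by
          rw [smul_sub, smul_smul, mul_inv_cancel_left₀ hc0]
        rw [this, modulus_smul, hc, one_smul]
      rw [h3] at h2
      refine h2.trans ⟨(K + δ + 1) • (n + k), smul_nonneg (by positivity) (add_nonneg hn hk), by
        rw [map_smul, map_add, hn', hk', add_zero, smul_zero], ?_⟩
      have h4 : c • z - d • w = (c • z - L.ofReal (e + n)) + ((-1 : ℂ) • (d • w - L.ofReal (e + k))
          + L.ofReal (n - k)) := by
        simp only [map_add, map_sub]
        module
      have h5 : |n - k| ≤ n + k := abs_le'.2 ⟨by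
        rw [sub_eq_add_neg]; exact add_le_add le_rfl ((neg_nonpos.2 hk).trans hk), by
        rw [neg_sub, sub_eq_add_neg, add_comm]
        exact add_le_add ((neg_nonpos.2 hn).trans hn) le_rfl⟩
      rw [h4]
      refine (L.modulus_add_le _ _).trans ?_
      refine (add_le_add (hdist z _ hzn c hc) (L.modulus_add_le _ _)).trans ?_
      rw [modulus_smul, norm_neg, norm_one, one_smul, modulus_ofReal]
      refine (add_le_add le_rfl (add_le_add (hdist w _ hwk d hd) h5)).trans (le_of_eq ?_)
      module
    have h2 : ∀ d : ℂ, ‖d‖ = 1 → NullLE φ (L.re (d • w)) (e + (K⁻¹ * (2 * δ - κ)) • e) := by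
      intro d hd
      have h3 : NullLE φ (L.modulus z) (e + (e - L.re (d • w)) + (K⁻¹ * (2 * δ - κ)) • e) := by
        refine L.nullLE_modulus hφ fun c hc => (h1 c d hc hd).rearrange (inv_nonneg.2 hK.le) ?_
        match_scalars <;> field_simp
        ring
      exact (hz'.trans h3).rearrange zero_le_one (by module)
    have h3 := (hw'.trans (L.nullLE_modulus hφ h2)).apply_le hφ
    rw [map_add, map_smul, hφe, smul_eq_mul, mul_one, le_add_iff_nonneg_right] at h3
    have h4 := nonneg_of_mul_nonneg_right h3 (inv_pos.2 hK)
    linarith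
  by_contra! hκ
  have h1 := main (min (κ / 3) 1) (by positivity) (min_le_right _ _)
  have h2 := min_le_left (κ / 3) 1
  linarith

/-! ### Subspaces on which the modulus is dominated by its image under a positive projection -/

section DominatedSubspace

variable {P : X →ₗ[ℝ] X}

/-- If `φ ∘ P = φ` and `φ` is a lattice homomorphism on the range of `P`, then `|z| ≤ P |z|` forces
`|z|` to be a multiple of one fixed vector `e`, modulo the null space of `φ`. -/
theorem nullLE_modulus_smul (hφP : ∀ x, φ (P x) = φ x) (hφl : ∀ x, φ (P x)⁺ = (φ x)⁺)
    (hidem : ∀ x, P (P x) = P x)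
    {e : X} (he : P e = e) (hφe : φ e = 1) {z : E} (hz : L.modulus z ≤ P (L.modulus z)) :
    NullLE φ (L.modulus z) (φ (L.modulus z) • e) ∧
      NullLE φ (φ (L.modulus z) • e) (L.modulus z) := by
  set m := L.modulus z
  set y := P m - φ m • e with hy
  have hPy : P y = y := by rw [hy, map_sub, map_smul, hidem, he]
  have hφy : φ y = 0 := by rw [hy, map_sub, map_smul, hφP, hφe, smul_eq_mul, mul_one, sub_self]
  have habs : φ |y| = 0 := by
    have h1 := hφl y
    have h2 := hφl (-y)
    rw [hPy, hφy, posPart_zero] at h1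
    rw [map_neg, hPy, map_neg, hφy, neg_zero, posPart_zero, posPart_neg] at h2
    rw [← posPart_add_negPart y, map_add, h1, h2, add_zero]
  constructor
  · refine ⟨|y|, abs_nonneg y, habs, hz.trans ?_⟩
    rw [← sub_le_iff_le_add']
    exact le_abs_self y
  · refine ⟨(P m - m) + |y|, add_nonneg (sub_nonneg.2 hz) (abs_nonneg y), by
      rw [map_add, map_sub, hφP, sub_self, habs, zero_add], ?_⟩
    have h := neg_le_abs y
    rw [hy, neg_sub, sub_le_iff_le_add'] at h
    rw [← add_assoc, add_sub_cancel]
    exact h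

variable {G : Submodule ℂ E}

/-- The seminorm `z ↦ φ |z|` vanishes on a subspace of `G` of codimension at most one. -/
theorem exists_apply_modulus_sub_smul_eq_zero
    (hG : ∀ z ∈ G, L.modulus z ≤ P (L.modulus z)) (hpos : ∀ x, 0 ≤ x → 0 ≤ P x)
    (hidem : ∀ x, P (P x) = P x) (hφ : ∀ x, 0 ≤ x → 0 ≤ φ x)
    (hφP : ∀ x, φ (P x) = φ x) (hφl : ∀ x, φ (P x)⁺ = (φ x)⁺)
    {z w : E} (hz : z ∈ G) (hw : w ∈ G) (hw0 : φ (L.modulus w) ≠ 0) :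
    ∃ α : ℂ, φ (L.modulus (z - α • w)) = 0 := by
  rcases eq_or_ne (φ (L.modulus z)) 0 with hz0 | hz0
  · exact ⟨0, by rwa [zero_smul, sub_zero]⟩
  have hφm : ∀ v, 0 ≤ φ (L.modulus v) := fun v => hφ _ (L.modulus_nonneg v)
  have hnorm : ∀ v : E, φ (L.modulus v) ≠ 0 →
      φ (L.modulus (((φ (L.modulus v))⁻¹ : ℝ) • v)) = 1 := by
    intro v hv
    rw [← Complex.coe_smul, modulus_smul, Complex.norm_real, Real.norm_of_nonneg
      (inv_nonneg.2 (hφm v)), map_smul, smul_eq_mul, inv_mul_cancel₀ hv]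
  set z' : E := ((φ (L.modulus z))⁻¹ : ℝ) • z with hz'
  set w' : E := ((φ (L.modulus w))⁻¹ : ℝ) • w with hw'
  have hzG : z' ∈ G := by
    rw [hz', ← Complex.coe_smul]
    exact G.smul_mem _ hz
  have hwG : w' ∈ G := by
    rw [hw', ← Complex.coe_smul]
    exact G.smul_mem _ hw
  have hz1 : φ (L.modulus z') = 1 := hnorm z hz0
  have hw1 : φ (L.modulus w') = 1 := hnorm w hw0
  set e := P (L.modulus w') with he
  have hPe : P e = e := hidem _
  have hφe : φ e = 1 := by rw [he, hφP, hw1]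
  have hmod := fun (v : E) (hv : v ∈ G) =>
    L.nullLE_modulus_smul hφP hφl hidem hPe hφe (hG v hv)
  have hcont : Continuous fun α : ℂ => φ (L.modulus (z' - α • w')) := by
    refine (LipschitzWith.of_le_add_mul 1 fun α β => ?_).continuous
    have h1 : z' - α • w' = (z' - β • w') + (β - α) • w' := by module
    have h2 := map_mono_of_nonneg hφ (L.modulus_add_le (z' - β • w') ((β - α) • w'))
    rw [← h1, map_add, modulus_smul, map_smul, hw1, smul_eq_mul, mul_one, ← dist_eq_norm,
      dist_comm] at h2
    simpa using h2
  -- the minimum over the unit circle is attained, and it cannot be positive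
  obtain ⟨α, -, hmin⟩ := (isCompact_sphere (0 : ℂ) 1).exists_isMinOn
    ⟨1, by simp⟩ hcont.continuousOn
  have hle : φ (L.modulus (z' - α • w')) ≤ 0 := by
    have hz2 := hmod z' hzG
    have hw2 := hmod w' hwG
    rw [hz1, one_smul] at hz2
    rw [hw1, one_smul] at hw2
    refine L.le_zero_of_forall_nullLE_modulus_sub hφ hφe hz2.1 hz2.2 hw2.1 hw2.2 fun β hβ => ?_
    refine NullLE.trans (NullLE.of_le (smul_le_smul_of_nonneg_right
      (isMinOn_iff.1 hmin β (mem_sphere_zero_iff_norm.2 hβ)) (hpos _ (L.modulus_nonneg w')))) ?_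
    exact (hmod _ (G.sub_mem hzG (G.smul_mem β hwG))).2
  refine ⟨(φ (L.modulus z) : ℂ) * α * ((φ (L.modulus w) : ℝ) : ℂ)⁻¹, ?_⟩
  have h1 : z - ((φ (L.modulus z) : ℂ) * α * ((φ (L.modulus w) : ℂ))⁻¹) • w =
      (φ (L.modulus z) : ℂ) • (z' - α • w') := by
    have hzC : (φ (L.modulus z) : ℂ) ≠ 0 := by exact_mod_cast hz0
    rw [hz', hw', ← Complex.coe_smul, ← Complex.coe_smul, smul_sub, smul_smul, smul_smul, smul_smul,
      Complex.ofReal_inv, Complex.ofReal_inv, mul_inv_cancel₀ hzC, one_smul]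
  rw [h1, modulus_smul, map_smul, le_antisymm hle (hφm _), smul_zero]

theorem exists_linearMap_detecting_apply_modulus
    (hG : ∀ z ∈ G, L.modulus z ≤ P (L.modulus z)) (hpos : ∀ x, 0 ≤ x → 0 ≤ P x)
    (hidem : ∀ x, P (P x) = P x) (hφ : ∀ x, 0 ≤ x → 0 ≤ φ x)
    (hφP : ∀ x, φ (P x) = φ x) (hφl : ∀ x, φ (P x)⁺ = (φ x)⁺) :
    ∃ ℓ : G →ₗ[ℂ] ℂ, ∀ z : G, ℓ z = 0 → φ (L.modulus (z : E)) = 0 := by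
  by_cases h : ∀ z : G, φ (L.modulus (z : E)) = 0
  · exact ⟨0, fun z _ => h z⟩
  push Not at h
  obtain ⟨w, hw⟩ := h
  let N : Submodule ℂ G :=
    { carrier := {z | φ (L.modulus (z : E)) = 0}
      zero_mem' := by
        change φ (L.modulus (0 : E)) = 0
        rw [modulus_zero, map_zero]
      add_mem' := by
        intro a b ha hb
        change φ (L.modulus (a + b : E)) = 0
        refine le_antisymm ?_ (hφ _ (L.modulus_nonneg _))
        refine (map_mono_of_nonneg hφ (L.modulus_add_le (a : E) b)).trans_eq ?_
        rw [map_add, show φ (L.modulus (a : E)) = 0 from ha,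
          show φ (L.modulus (b : E)) = 0 from hb, add_zero]
      smul_mem' := by
        intro c a ha
        change φ (L.modulus (c • (a : E))) = 0
        rw [modulus_smul, map_smul, show φ (L.modulus (a : E)) = 0 from ha, smul_zero] }
  have hwN : N.mkQ w ≠ 0 := by
    rw [Submodule.mkQ_apply, Ne, Submodule.Quotient.mk_eq_zero]
    exact hw
  obtain ⟨f, hf⟩ : ∃ f : Module.Dual ℂ (G ⧸ N), f (N.mkQ w) ≠ 0 := by
    by_contra! hf
    exact hwN ((Module.forall_dual_apply_eq_zero_iff ℂ _).1 hf)
  refine ⟨f ∘ₗ N.mkQ, fun z hz => ?_⟩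
  obtain ⟨α, hα⟩ := L.exists_apply_modulus_sub_smul_eq_zero hG hpos hidem hφ hφP hφl z.2 w.2 hw
  have h1 : N.mkQ z = α • N.mkQ w := by
    rw [← sub_eq_zero, ← map_smul, ← map_sub, Submodule.mkQ_apply, Submodule.Quotient.mk_eq_zero]
    exact hα
  rw [LinearMap.comp_apply, h1, map_smul, smul_eq_mul, mul_eq_zero, or_iff_left hf] at hz
  rwa [hz, zero_smul, sub_zero] at hα

/-- A complex subspace on which `|z| ≤ P |z|`, for a positive projection `P` of finite rank, has at
most the dimension of the range of `P`. -/
theorem rank_le_of_modulus_le [FiniteDimensional ℝ (LinearMap.range P)]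
    (hG : ∀ z ∈ G, L.modulus z ≤ P (L.modulus z)) (hpos : ∀ x, 0 ≤ x → 0 ≤ P x)
    (hidem : ∀ x, P (P x) = P x) :
    Module.rank ℂ G ≤ Module.finrank ℝ (LinearMap.range P) := by
  obtain ⟨S, hcard, hS, hdet⟩ := exists_finset_latticeFunctionals hpos hidem
  have hex : ∀ φ : S, ∃ ℓ : G →ₗ[ℂ] ℂ, ∀ z : G, ℓ z = 0 → φ.1 (L.modulus (z : E)) = 0 :=
    fun φ => L.exists_linearMap_detecting_apply_modulus hG hpos hidem (hS φ φ.2).1 (hS φ φ.2).2.1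
      (hS φ φ.2).2.2
  choose ℓ hℓ using hex
  have hinj : Function.Injective (LinearMap.pi ℓ) := by
    rw [← LinearMap.ker_eq_bot, LinearMap.ker_eq_bot']
    intro z hz
    have h1 : P (L.modulus (z : E)) = 0 :=
      hdet _ (L.modulus_nonneg _) fun φ hφ => hℓ ⟨φ, hφ⟩ z (congrFun hz ⟨φ, hφ⟩)
    have h2 := hG z z.2
    rw [h1] at h2
    exact Subtype.ext (L.eq_zero_of_modulus_eq_zero (le_antisymm h2 (L.modulus_nonneg _)))
  have : FiniteDimensional ℂ G := Module.Finite.of_injective _ hinj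
  have h1 := LinearMap.finrank_le_finrank_of_injective hinj
  rw [Module.finrank_fintype_fun_eq_card, Fintype.card_coe] at h1
  rw [← Module.finrank_eq_rank]
  exact_mod_cast h1.trans hcard

end DominatedSubspace

end ComplexBanachLattice

/-! ### Simple poles of the resolvent -/

section ResolventPole

open Filter Topology
open scoped ENNReal NNReal

variable {E : Type*} [NormedAddCommGroup E] [NormedSpace ℂ E]

theorem sub_mul_resolvent {T : E →L[ℂ] E} {z : ℂ} (hz : z ∈ resolventSet ℂ T) :
    (z • (1 : E →L[ℂ] E) - T) * resolvent T z = 1 := by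
  have := Ring.mul_inverse_cancel _ hz
  rwa [Algebra.algebraMap_eq_smul_one] at this

theorem resolvent_mul_sub {T : E →L[ℂ] E} {z : ℂ} (hz : z ∈ resolventSet ℂ T) :
    resolvent T z * (z • (1 : E →L[ℂ] E) - T) = 1 := by
  have := Ring.inverse_mul_cancel _ hz
  rwa [Algebra.algebraMap_eq_smul_one] at this

theorem resolvent_apply_of_eigenvector {T : E →L[ℂ] E} {z μ : ℂ} (hz : z ∈ resolventSet ℂ T)
    (hne : z ≠ μ) {x : E} (hx : T x = μ • x) : resolvent T z x = (z - μ)⁻¹ • x := by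
  have h := congrArg (fun A : E →L[ℂ] E => A x) (resolvent_mul_sub hz)
  change resolvent T z (z • x - T x) = x at h
  rw [hx, ← sub_smul, map_smul] at h
  rw [eq_inv_smul_iff₀ (sub_ne_zero.2 hne), h]

/-- The residue `P` of the resolvent at a simple pole `μ` satisfies `P T = μ P`, maps into the
eigenspace of `μ` and fixes it pointwise. -/
theorem exists_residue_of_simplePole {T : E →L[ℂ] E} {μ : ℂ} (h : IsResolventPoleOfOrder T μ 1)
    (hres : ∀ᶠ z in 𝓝[≠] μ, z ∈ resolventSet ℂ T) :
    ∃ P : E →L[ℂ] E, Tendsto (fun z => (z - μ) • resolvent T z) (𝓝[≠] μ) (𝓝 P) ∧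
      P * T = μ • P ∧ T * P = μ • P ∧ ∀ x, T x = μ • x → P x = x := by
  obtain ⟨g, hg, -, hgeq⟩ := (meromorphicOrderAt_eq_int_iff h.1).1 h.2
  have hlim : Tendsto (fun z => (z - μ) • resolvent T z) (𝓝[≠] μ) (𝓝 (g μ)) := by
    refine (hg.continuousAt.tendsto.mono_left nhdsWithin_le_nhds).congr' ?_
    filter_upwards [hgeq, self_mem_nhdsWithin] with z hz hzne
    have hz0 : z - μ ≠ 0 := sub_ne_zero.2 hzne
    rw [hz, smul_smul]
    simp [hz0]
  have hid : Tendsto (fun z : ℂ => z) (𝓝[≠] μ) (𝓝 μ) := nhdsWithin_le_nhds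
  have hrhs : Tendsto (fun z => z • ((z - μ) • resolvent T z) - (z - μ) • (1 : E →L[ℂ] E))
      (𝓝[≠] μ) (𝓝 (μ • g μ)) := by
    have h1 := (hid.smul hlim).sub ((hid.sub_const μ).smul_const (1 : E →L[ℂ] E))
    simpa using h1
  refine ⟨g μ, hlim, ?_, ?_, ?_⟩
  · refine tendsto_nhds_unique ((hlim.mul_const T).congr' ?_) hrhs
    filter_upwards [hres] with z hz
    have h1 := resolvent_mul_sub hz
    rw [mul_sub, mul_smul_comm, mul_one, sub_eq_iff_eq_add', ← sub_eq_iff_eq_add] at h1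
    rw [smul_mul_assoc, ← h1]
    module
  · refine tendsto_nhds_unique ((hlim.const_mul T).congr' ?_) hrhs
    filter_upwards [hres] with z hz
    have h1 := sub_mul_resolvent hz
    rw [sub_mul, smul_mul_assoc, one_mul, sub_eq_iff_eq_add', ← sub_eq_iff_eq_add] at h1
    rw [mul_smul_comm, ← h1]
    module
  · intro x hx
    refine tendsto_nhds_unique (((ContinuousLinearMap.apply ℂ E x).continuous.tendsto _).comp hlim)
      (tendsto_const_nhds.congr' ?_)
    filter_upwards [hres, self_mem_nhdsWithin] with z hz hzne
    change x = (z - μ) • resolvent T z x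
    rw [resolvent_apply_of_eigenvector hz hzne hx, smul_inv_smul₀ (sub_ne_zero.2 hzne)]

variable [CompleteSpace E]

/-- The spectral projection fixes the eigenvectors of `μ`. -/
theorem circleProjection_apply_of_eigenvector {T : E →L[ℂ] E} {μ : ℂ} {r : ℝ} (hr : 0 < r)
    (hspec : spectrum ℂ T ∩ Metric.closedBall μ r = {μ}) {x : E} (hx : T x = μ • x) :
    circleProjection T μ r x = x := by
  have hne : ∀ z ∈ Metric.sphere μ r, z ≠ μ := fun z hz h => by
    rw [h, Metric.mem_sphere, dist_self] at hz
    exact hr.ne hz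
  have hres : ∀ z ∈ Metric.sphere μ r, z ∈ resolventSet ℂ T := by
    intro z hz
    by_contra hmem
    have h1 : z ∈ spectrum ℂ T ∩ Metric.closedBall μ r :=
      ⟨hmem, Metric.sphere_subset_closedBall hz⟩
    rw [hspec] at h1
    exact hne z hz h1
  have hcont : ContinuousOn (fun z => resolvent T z) (Metric.sphere μ r) := fun z hz =>
    (spectrum.hasDerivAt_resolvent_const_left (hres z hz)).continuousAt.continuousWithinAt
  have hint := (hcont.circleIntegrable hr.le).out
  have h1 : (circleIntegral (fun z => resolvent T z) μ r) x =
      circleIntegral (fun z => resolvent T z x) μ r := by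
    unfold circleIntegral
    rw [ContinuousLinearMap.intervalIntegral_apply hint]
    rfl
  have h2 : circleIntegral (fun z => resolvent T z x) μ r =
      circleIntegral (fun z => (z - μ)⁻¹ • x) μ r :=
    circleIntegral.integral_congr hr.le fun z hz =>
      resolvent_apply_of_eigenvector (hres z hz) (hne z hz) hx
  rw [circleProjection, smul_apply, h1, h2, circleIntegral.integral_smul_const,
    circleIntegral.integral_sub_center_inv _ hr.ne', smul_smul,
    inv_mul_cancel₀ Complex.two_pi_I_ne_zero, one_smul]

theorem spectralRadius_lt_of_specRadius_lt {T : E →L[ℂ] E} {t : ℝ} (ht : specRadius T < t) :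
    spectralRadius ℂ T < ‖(t : ℂ)‖₊ := by
  have hfin : spectralRadius ℂ T ≠ ∞ := by
    rcases subsingleton_or_nontrivial E with h | h
    · rw [spectrum.SpectralRadius.of_subsingleton]
      exact ENNReal.zero_ne_top
    · exact ((spectrum.spectralRadius_le_nnnorm T).trans_lt ENNReal.coe_lt_top).ne
  have h0 : 0 ≤ specRadius T := ENNReal.toReal_nonneg
  rw [← ENNReal.toReal_lt_toReal hfin ENNReal.coe_ne_top, ENNReal.coe_toReal, coe_nnnorm,
    Complex.norm_real, Real.norm_of_nonneg (h0.trans ht.le)]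
  exact ht

/-- The Neumann series of the resolvent outside of the disk of the spectral radius. -/
theorem hasSum_resolvent {T : E →L[ℂ] E} {t : ℝ} (ht : specRadius T < t) :
    HasSum (fun n : ℕ => ((t : ℂ)⁻¹ ^ (n + 1)) • T ^ n) (resolvent T (t : ℂ)) := by
  have ht0 : (t : ℂ) ≠ 0 := by
    exact_mod_cast (lt_of_le_of_lt ENNReal.toReal_nonneg ht).ne'
  have hlt : ((‖(t : ℂ)⁻¹‖₊ : ℝ≥0) : ℝ≥0∞) < (spectralRadius ℂ T)⁻¹ := by
    rw [nnnorm_inv, ENNReal.coe_inv (nnnorm_ne_zero_iff.2 ht0), ENNReal.inv_lt_inv]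
    exact spectralRadius_lt_of_specRadius_lt ht
  obtain ⟨s, hs1, hs2⟩ := ENNReal.lt_iff_exists_nnreal_btwn.1 hlt
  have hs0 : 0 < s := (zero_le).trans_lt (ENNReal.coe_lt_coe.1 hs1)
  have H := ((spectrum.differentiableOn_inverse_one_sub_smul hs2).hasFPowerSeriesOnBall hs0)
  have H' := (spectrum.hasFPowerSeriesOnBall_inverse_one_sub_smul ℂ T).exchange_radius H
  have hsum := H'.hasSum (y := (t : ℂ)⁻¹) (by
    rw [Metric.mem_eball, edist_zero_right]
    exact hs1)
  have h1 : Ring.inverse (1 - (0 + (t : ℂ)⁻¹) • T) = (t : ℂ) • resolvent T (t : ℂ) := by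
    have h2 := spectrum.units_smul_resolvent (R := ℂ) (A := E →L[ℂ] E) (r := Units.mk0 (t : ℂ) ht0)
      (s := (t : ℂ)) (a := T)
    rw [Units.smul_def, Units.val_mk0] at h2
    rw [h2, zero_add, resolvent, Units.smul_def, Units.smul_def, Units.val_inv_eq_inv_val,
      Units.val_mk0, smul_eq_mul, inv_mul_cancel₀ ht0, map_one]
  rw [h1] at hsum
  have h3 := hsum.const_smul (t : ℂ)⁻¹
  rw [inv_smul_smul₀ ht0] at h3
  refine (congrArg (fun u => HasSum u _) (funext fun n => ?_)).mpr h3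
  rw [ContinuousMultilinearMap.mkPiRing_apply, Finset.prod_const, Finset.card_univ, Fintype.card_fin,
    smul_smul, pow_succ']

end ResolventPole

/-! ### The spectral projection of an eventually positive operator -/

namespace ComplexBanachLattice

open Filter Topology

variable {X E : Type*}
  [NormedAddCommGroup X] [NormedSpace ℝ X] [CompleteSpace X] [Lattice X]
  [IsOrderedAddMonoid X] [IsOrderedModule ℝ X] [HasSolidNorm X]
  [NormedAddCommGroup E] [NormedSpace ℂ E] (L : ComplexBanachLattice X E)

/-- An Abelian argument: if `T ^ k f ≥ r ^ k g` for all large `k`, then `P f ≥ g`, where `P` is the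
residue of the resolvent at the simple pole `r`. -/
theorem nonneg_residue_apply_sub [CompleteSpace E] {T P : E →L[ℂ] E} (hr : 0 < specRadius T)
    (hlim : Tendsto (fun z : ℂ => (z - specRadius T) • resolvent T z)
      (𝓝[≠] (specRadius T : ℂ)) (𝓝 P))
    (hPT : P * T = (specRadius T : ℂ) • P) {f g : E} {n₀ : ℕ}
    (h : ∀ k, n₀ ≤ k → L.Nonneg ((T ^ k) f - ((specRadius T : ℂ) ^ k) • g)) :
    L.Nonneg (P f - g) := by
  set r := specRadius T with hrdef
  have hr0 : (r : ℂ) ≠ 0 := by exact_mod_cast hr.ne'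
  have hPpow : ∀ n, (P * T ^ n) f = (r : ℂ) ^ n • P f := by
    intro n
    induction n with
    | zero => simp
    | succ n ih =>
      rw [pow_succ', ← mul_assoc, hPT, smul_mul_assoc, smul_apply, ih, smul_smul, pow_succ']
  have hseries : ∀ t : ℝ, r < t → L.Nonneg
      ((((t : ℂ) - r) • resolvent T (t : ℂ)) ((T ^ n₀) f) - (r : ℂ) ^ n₀ • g) := by
    intro t ht
    have ht0 : 0 < t := hr.trans ht
    have htC : (t : ℂ) ≠ 0 := by exact_mod_cast ht0.ne'
    have htr : (t : ℂ) - r ≠ 0 := by exact_mod_cast (sub_pos.2 ht).ne'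
    have h1 : HasSum (fun n : ℕ => ((t : ℂ)⁻¹ ^ (n + 1)) • (T ^ (n + n₀)) f)
        (resolvent T (t : ℂ) ((T ^ n₀) f)) := by
      have := (hasSum_resolvent ht).mapL (ContinuousLinearMap.apply ℂ E ((T ^ n₀) f))
      simpa [pow_add] using this
    have h2 : HasSum (fun n : ℕ => ((t : ℂ)⁻¹ ^ (n + 1) * (r : ℂ) ^ n)) ((t : ℂ) - r)⁻¹ := by
      have hlt : ‖(r : ℂ) / t‖ < 1 := by
        rw [norm_div, Complex.norm_real, Complex.norm_real, Real.norm_of_nonneg hr.le,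
          Real.norm_of_nonneg ht0.le, div_lt_one ht0]
        exact ht
      have h3 := (hasSum_geometric_of_norm_lt_one hlt).mul_left (t : ℂ)⁻¹
      have h4 : (t : ℂ)⁻¹ * (1 - (r : ℂ) / t)⁻¹ = ((t : ℂ) - r)⁻¹ := by
        rw [← mul_inv, mul_sub, mul_one, mul_div_cancel₀ _ htC]
      rw [h4] at h3
      refine (congrArg (fun u => HasSum u _) (funext fun n => ?_)).mpr h3
      rw [div_eq_mul_inv, mul_pow]
      ring
    have h4 := (h1.sub (h2.smul_const ((r : ℂ) ^ n₀ • g))).const_smul ((t : ℂ) - r)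
    rw [smul_sub, smul_inv_smul₀ htr] at h4
    refine L.nonneg_of_hasSum h4 fun n => ?_
    have h5 := (h (n + n₀) (Nat.le_add_left _ _)).smul
      (a := (t - r) * t⁻¹ ^ (n + 1)) (by have := sub_pos.2 ht; positivity)
    convert h5 using 1
    push_cast
    rw [pow_add]
    module
  have hlim' : Tendsto (fun t : ℝ => (((t : ℂ) - r) • resolvent T (t : ℂ)) ((T ^ n₀) f)
      - (r : ℂ) ^ n₀ • g) (𝓝[>] r) (𝓝 (P ((T ^ n₀) f) - (r : ℂ) ^ n₀ • g)) := by
    have h1 : Tendsto (fun t : ℝ => (t : ℂ)) (𝓝[>] r) (𝓝[≠] (r : ℂ)) := by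
      refine tendsto_nhdsWithin_iff.2 ⟨?_, ?_⟩
      · exact Complex.continuous_ofReal.continuousAt.tendsto.mono_left nhdsWithin_le_nhds
      · filter_upwards [self_mem_nhdsWithin] with t ht
        exact fun h => (ne_of_gt (Set.mem_Ioi.1 ht)) (Complex.ofReal_injective h)
    exact ((((ContinuousLinearMap.apply ℂ E ((T ^ n₀) f)).continuous.tendsto _).comp
      (hlim.comp h1)).sub_const _)
  have h1 : L.Nonneg (P ((T ^ n₀) f) - (r : ℂ) ^ n₀ • g) := by
    refine L.isClosed_nonneg.mem_of_tendsto hlim' ?_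
    filter_upwards [self_mem_nhdsWithin] with t ht
    exact hseries t ht
  have h2 := h1.smul (a := (r ^ n₀)⁻¹) (by positivity)
  have h3 : P ((T ^ n₀) f) = (r : ℂ) ^ n₀ • P f := hPpow n₀
  rw [h3, ← smul_sub, Complex.ofReal_inv, Complex.ofReal_pow,
    inv_smul_smul₀ (pow_ne_zero _ hr0)] at h2
  exact h2

/-- An eigenvector `z` for an eigenvalue of modulus `r` satisfies `r ^ n |z| ≤ T ^ n |z|` as soon as
`T ^ n` is positive. -/
theorem nonneg_pow_apply_modulus_sub {T : E →L[ℂ] E} {n : ℕ} (hT : L.IsPositiveOperator (T ^ n))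
    {μ : ℂ} {r : ℝ} (hμ : ‖μ‖ = r) {z : E} (hz : T z = μ • z) :
    L.Nonneg ((T ^ n) (L.ofReal (L.modulus z)) - (r : ℂ) ^ n • L.ofReal (L.modulus z)) := by
  have hpow : ∀ k, (T ^ k) z = μ ^ k • z := by
    intro k
    induction k with
    | zero => simp
    | succ k ih => rw [pow_succ, mul_apply_eq_comp, hz, map_smul, ih, smul_smul, pow_succ']
  have h1 := hT.modulus_apply_le z
  rw [hpow, modulus_smul, norm_pow, hμ] at h1
  refine ⟨_, sub_nonneg.2 h1, ?_⟩
  rw [map_sub, hT.ofReal_re, map_smul, ← Complex.coe_smul, Complex.ofReal_pow]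

theorem linearIndependent_ofReal {ι : Type*} [Fintype ι] {b : ι → X} (hb : LinearIndependent ℝ b) :
    LinearIndependent ℂ fun i => L.ofReal (b i) := by
  rw [Fintype.linearIndependent_iff] at hb ⊢
  intro c hc i
  have key : ∀ d : ℂ, (d * c i).re = 0 := by
    intro d
    refine hb (fun i => (d * c i).re) ?_ i
    have h1 := congrArg (fun v => L.re (d • v)) hc
    simpa [Finset.smul_sum, smul_smul, re_smul_ofReal] using h1
  have h1 := key 1
  have h2 := key Complex.I
  rw [one_mul] at h1
  rw [Complex.I_mul_re, neg_eq_zero] at h2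
  exact Complex.ext h1 h2

end ComplexBanachLattice

open Filter Topology ComplexBanachLattice in
theorem theorem4p4 {X E : Type*}
    [NormedAddCommGroup X] [NormedSpace ℝ X] [CompleteSpace X] [Lattice X]
    [IsOrderedAddMonoid X] [IsOrderedModule ℝ X] [HasSolidNorm X]
    [NormedAddCommGroup E] [NormedSpace ℂ E] [CompleteSpace E]
    (L : ComplexBanachLattice X E) (T : E →L[ℂ] E)
    (hT : L.IsUniformlyEventuallyPositive T)
    (hriesz : IsRieszPoint T (specRadius T : ℂ))
    (hpole : IsResolventPoleOfOrder T (specRadius T : ℂ) 1)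
    (μ : ℂ) (hμ : ‖μ‖ = specRadius T) :
    Module.rank ℂ (LinearMap.ker ((μ • (1 : E →L[ℂ] E) - T : E →L[ℂ] E) : E →ₗ[ℂ] E)) ≤
      Module.rank ℂ
        (LinearMap.ker (((specRadius T : ℂ) • (1 : E →L[ℂ] E) - T : E →L[ℂ] E) : E →ₗ[ℂ] E)) := by
  have hker : ∀ (ν : ℂ) (x : E), x ∈ LinearMap.ker ((ν • (1 : E →L[ℂ] E) - T : E →L[ℂ] E) :
      E →ₗ[ℂ] E) ↔ T x = ν • x := by
    intro ν x
    change ν • x - T x = 0 ↔ _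
    rw [sub_eq_zero, eq_comm]
  have hr0 : 0 ≤ specRadius T := ENNReal.toReal_nonneg
  -- if the spectral radius is `0`, both eigenspaces are the kernel of `T`
  rcases hr0.eq_or_lt with hr | hr
  · rw [← hr, norm_eq_zero] at hμ
    rw [← hr, hμ, Complex.ofReal_zero]
  obtain ⟨-, -, Q, ⟨ρ, hρ, hspec, rfl⟩, hQfin⟩ := hriesz
  have hres : ∀ᶠ z in 𝓝[≠] (specRadius T : ℂ), z ∈ resolventSet ℂ T := by
    filter_upwards [self_mem_nhdsWithin,
      nhdsWithin_le_nhds (Metric.closedBall_mem_nhds (specRadius T : ℂ) hρ)] with z hz hzρ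
    by_contra hmem
    have h1 : z ∈ spectrum ℂ T ∩ Metric.closedBall (specRadius T : ℂ) ρ := ⟨hmem, hzρ⟩
    rw [hspec] at h1
    exact hz h1
  obtain ⟨P, hlim, hPT, hTP, hfix⟩ := exists_residue_of_simplePole hpole hres
  set K := LinearMap.ker (((specRadius T : ℂ) • (1 : E →L[ℂ] E) - T : E →L[ℂ] E) : E →ₗ[ℂ] E)
    with hK
  have hKfin : FiniteDimensional ℂ K := by
    refine Submodule.finiteDimensional_of_le (S₂ := LinearMap.range
      (circleProjection T (specRadius T : ℂ) ρ : E →ₗ[ℂ] E)) fun x hx => ?_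
    exact ⟨x, circleProjection_apply_of_eigenvector hρ hspec ((hker _ x).1 hx)⟩
  have hPK : ∀ x, P x ∈ K := fun x =>
    (hker _ _).2 (congrArg (fun A : E →L[ℂ] E => A x) hTP)
  have hPP : ∀ x, P (P x) = P x := fun x => hfix _ ((hker _ _).1 (hPK x))
  obtain ⟨n₀, hn₀⟩ := hT
  have hPpos : L.IsPositiveOperator P := by
    intro f hf
    have h1 := L.nonneg_residue_apply_sub hr hlim hPT (f := f) (g := 0) (n₀ := n₀) fun k hk => by
      rw [smul_zero, sub_zero]
      exact hn₀ k hk f hf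
    rwa [sub_zero] at h1
  -- the operator induced by the residue on the real part of `E`
  let p : X →ₗ[ℝ] X := L.re ∘ₗ ((P : E →ₗ[ℂ] E).restrictScalars ℝ) ∘ₗ L.ofReal
  have hp : ∀ x, L.ofReal (p x) = P (L.ofReal x) := fun x => hPpos.ofReal_re x
  have hppos : ∀ x, 0 ≤ x → 0 ≤ p x := by
    intro x hx
    have h1 := hPpos _ (L.nonneg_ofReal_iff.2 hx)
    rwa [← hp, nonneg_ofReal_iff] at h1
  have hpidem : ∀ x, p (p x) = p x := fun x =>
    L.isometry_ofReal.injective (by rw [hp, hp, hPP])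
  have hpK : ∀ x ∈ LinearMap.range p, L.ofReal x ∈ K := by
    rintro _ ⟨x, rfl⟩
    rw [hp]
    exact hPK _
  have hpfin : FiniteDimensional ℝ (LinearMap.range p) := by
    have : FiniteDimensional ℝ K := FiniteDimensional.complexToReal K
    let j : LinearMap.range p →ₗ[ℝ] K :=
      { toFun := fun x => ⟨L.ofReal x, hpK x x.2⟩
        map_add' := fun x y => Subtype.ext (map_add L.ofReal (x : X) y)
        map_smul' := fun a x => Subtype.ext (map_smul L.ofReal a (x : X)) }
    refine Module.Finite.of_injective j fun x y hxy => Subtype.ext ?_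
    exact L.isometry_ofReal.injective (congrArg Subtype.val hxy)
  have hrank : (Module.finrank ℝ (LinearMap.range p) : Cardinal) ≤ Module.rank ℂ K := by
    let b := Module.finBasis ℝ (LinearMap.range p)
    have h1 : LinearIndependent ℝ fun i => (b i : X) :=
      b.linearIndependent.map' (LinearMap.range p).subtype (Submodule.ker_subtype _)
    have h2 : LinearIndependent ℂ fun i => (⟨L.ofReal (b i), hpK _ (b i).2⟩ : K) :=
      LinearIndependent.of_comp K.subtype (L.linearIndependent_ofReal h1)
    have h3 := h2.fintype_card_le_finrank
    rw [Fintype.card_fin] at h3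
    rw [← Module.finrank_eq_rank]
    exact_mod_cast h3
  refine (L.rank_le_of_modulus_le (fun z hz => ?_) hppos hpidem).trans hrank
  have h1 := L.nonneg_residue_apply_sub hr hlim hPT (f := L.ofReal (L.modulus z))
    (g := L.ofReal (L.modulus z)) (n₀ := n₀) fun k hk =>
      L.nonneg_pow_apply_modulus_sub (hn₀ k hk) hμ ((hker _ z).1 hz)
  rwa [← hp, ← map_sub, nonneg_ofReal_iff, sub_nonneg] at h1
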